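/- Let $q_3 = x_1^2+x_2^2+x_3^2 \in \mathbb{C}[x_1,x_2,x_3]$. For a homogeneous polynomial $f\in\mathbb{C}[x_1,\dots,x_n]$ of degree $d \ge 1$, the (complex) Waring rank $\operatorname{rk} f$ is the least $r\in\mathbb{N}$ such that $f=\sum_{j=1}^{r}\ell_j^{\,d}$ for some linear forms $\ell_1,\dots,\ell_r$ with complex coefficients. Put $T_{n,s}=\binom{s+n-1}{s}$. Then $$\operatorname{rk}\bigl(q_3^4\bigr)=T_{3,4}+1=16 .$$ -/

import Mathlib

/-- The linear form `a₁ x₁ + ⋯ + aₙ xₙ` attached to a point `a ∈ ℂⁿ`. -/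
noncomputable def linearForm {n : ℕ} (a : Fin n → ℂ) : MvPolynomial (Fin n) ℂ :=
  ∑ i, MvPolynomial.C (a i) * MvPolynomial.X i

/-- A polynomial `f` has a Waring decomposition of size `r` in degree `d` if it is the sum of the
`d`-th powers of `r` linear forms with complex coefficients. -/
def HasWaringDecomposition {n : ℕ} (d : ℕ) (f : MvPolynomial (Fin n) ℂ) (r : ℕ) : Prop :=
  ∃ a : Fin r → Fin n → ℂ, f = ∑ j, linearForm (a j) ^ d

/-- The complex Waring rank of a form `f` of degree `d`: the least size of a Waring decomposition
of `f`. (Every form of degree `d ≥ 1` has one; in general the value is `0` if there is none.) -/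
noncomputable def waringRank {n : ℕ} (d : ℕ) (f : MvPolynomial (Fin n) ℂ) : ℕ :=
  sInf {r : ℕ | HasWaringDecomposition d f r}

/-- The quadratic form `qₙ = x₁² + ⋯ + xₙ²`. -/
noncomputable def quadForm (n : ℕ) : MvPolynomial (Fin n) ℂ :=
  ∑ i, MvPolynomial.X i ^ 2

/-- The size `T n s = C(s + n - 1, s)` of the middle catalecticant matrix of `qₙ ^ s` (for
`n ≥ 1`), which is the number of monomials of degree `s` in `n` variables. A decomposition of
`qₙ ^ s` of this size is called tight. -/
def tightSize (n s : ℕ) : ℕ := (s + n - 1).choose s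

/-! Lower bound: padding with zero forms reduces to 15 points. Comparing coefficients, their
degree-8 moments are Gaussian moments over 105 (`sum_monomial_eq`). For 15 points the evaluation
matrix on quartics is square, so the zonal kernel 21t⁴ - 14t² + 1 vanishes between distinct points
(`kernel_of_tight`). Hence 21t² - 7 = ±√28 there and 14 on the diagonal, while second moments make
these values sum to 0 (`sum_dot_sq_mul`). An integer of square 7 would result (`not_tight`).

Upper bound: degree-8 icosahedral invariants are spanned by q⁴ and q times a sextic, so a weighted
sum over the 6 + 10 axes can cancel the second (`icosahedral_identity`). -/

/-! ### Moments of a Waring decomposition of `q₃⁴` -/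

/-- The moments of the standard Gaussian distribution on the real line. -/
def gaussMoment (n : ℕ) : ℕ := if Even n then (n - 1).doubleFactorial else 0

lemma linearForm_eq_smul {n : ℕ} (a : Fin n → ℂ) :
    linearForm a = ∑ i, a i • (MvPolynomial.X i : MvPolynomial (Fin n) ℂ) := by
  simp [linearForm, MvPolynomial.smul_eq_C_mul]

lemma quadForm_eq_expand (n : ℕ) :
    quadForm n = MvPolynomial.expand 2 (∑ i, MvPolynomial.X i) := by
  simp [quadForm]

/-- The exponent vector `(i, j, k)` as a finitely supported function. -/
noncomputable def expVec (i j k : ℕ) : Fin 3 →₀ ℕ := Finsupp.equivFunOnFinite.symm ![i, j, k]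

lemma multinomial_expVec (i j k : ℕ) :
    (expVec i j k).multinomial = (i + j + k).choose i * (j + k).choose j := by
  rw [Finsupp.multinomial_eq_of_support_subset (Finset.subset_univ _)]
  have h : (Finset.univ : Finset (Fin 3)) = {0, 1, 2} := rfl
  rw [h, Nat.multinomial_insert (by decide), Nat.multinomial_insert (by decide)]
  simp [expVec, add_assoc]

lemma coeff_linearForm_pow (a : Fin 3 → ℂ) (i j k : ℕ) :
    MvPolynomial.coeff (expVec i j k) (linearForm a ^ (i + j + k)) =
      ((i + j + k).choose i * (j + k).choose j : ℕ) * (a 0 ^ i * a 1 ^ j * a 2 ^ k) := by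
  rw [linearForm_eq_smul, MvPolynomial.coeff_linearCombination_X_pow_of_fintype, if_pos,
    multinomial_expVec]
  · simp [Finsupp.prod_fintype, Fin.prod_univ_three, expVec]
  · simp [Finsupp.sum_fintype, Fin.sum_univ_three, expVec]

lemma coeff_quadForm_pow (i j k : ℕ) :
    MvPolynomial.coeff (expVec (2 * i) (2 * j) (2 * k)) (quadForm 3 ^ (i + j + k)) =
      ((i + j + k).choose i * (j + k).choose j : ℕ) := by
  have h : expVec (2 * i) (2 * j) (2 * k) = 2 • expVec i j k := by
    ext x
    fin_cases x <;> simp [expVec]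
  rw [quadForm_eq_expand, ← map_pow, h, MvPolynomial.coeff_expand_smul 2 two_ne_zero,
    MvPolynomial.coeff_sum_X_pow_of_fintype, if_pos, multinomial_expVec]
  simp [Finsupp.sum_fintype, Fin.sum_univ_three, expVec]

lemma coeff_quadForm_pow_eq_zero {i j k : ℕ} (h : ¬ (Even i ∧ Even j ∧ Even k)) (s : ℕ) :
    MvPolynomial.coeff (expVec i j k) (quadForm 3 ^ s) = 0 := by
  rw [quadForm_eq_expand, ← map_pow]
  simp only [even_iff_two_dvd] at h
  by_cases hi : 2 ∣ i
  · by_cases hj : 2 ∣ j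
    · exact MvPolynomial.coeff_expand_of_not_dvd _ (i := 2)
        fun hk => h ⟨hi, hj, hk⟩
    · exact MvPolynomial.coeff_expand_of_not_dvd _ (i := 1) hj
  · exact MvPolynomial.coeff_expand_of_not_dvd _ (i := 0) hi

lemma sum_monomial_eq {r : ℕ} {a : Fin r → Fin 3 → ℂ}
    (ha : quadForm 3 ^ 4 = ∑ l, linearForm (a l) ^ 8) (i j k : ℕ) (hd : i + j + k = 8) :
    105 * ∑ l, a l 0 ^ i * a l 1 ^ j * a l 2 ^ k =
      (gaussMoment i * gaussMoment j * gaussMoment k : ℕ) := by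
  have h := congrArg (MvPolynomial.coeff (expVec i j k)) ha
  rw [MvPolynomial.coeff_sum] at h
  simp_rw [← hd, coeff_linearForm_pow] at h
  rw [← Finset.mul_sum] at h
  have hM : ((i + j + k).choose i * (j + k).choose j : ℕ) ≠ 0 :=
    mul_ne_zero (Nat.choose_pos (by omega)).ne' (Nat.choose_pos (by omega)).ne'
  have hM' : (((i + j + k).choose i * (j + k).choose j : ℕ) : ℂ) ≠ 0 := Nat.cast_ne_zero.2 hM
  apply mul_left_cancel₀ hM'
  rw [mul_left_comm, ← h]
  by_cases he : Even i ∧ Even j ∧ Even k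
  · obtain ⟨⟨i, rfl⟩, ⟨j, rfl⟩, ⟨k, rfl⟩⟩ := he
    simp only [← two_mul] at *
    have h4 : 4 = i + j + k := by omega
    rw [h4, coeff_quadForm_pow]
    norm_cast
    have key : ∀ i < 5, ∀ j < 5, ∀ k < 5, i + j + k = 4 →
        105 * ((i + j + k).choose i * (j + k).choose j) =
        (2 * i + 2 * j + 2 * k).choose (2 * i) * (2 * j + 2 * k).choose (2 * j) *
          (gaussMoment (2 * i) * gaussMoment (2 * j) * gaussMoment (2 * k)) := by decide
    exact key i (by omega) j (by omega) k (by omega) h4.symm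
  · rw [coeff_quadForm_pow_eq_zero he]
    have h0 : gaussMoment i * gaussMoment j * gaussMoment k = 0 := by
      simp only [gaussMoment]
      split_ifs <;> simp_all
    simp [h0]

/-! ### The reproducing kernel of quartic forms -/

/-- The exponents of the monomials of degree four in three variables. -/
def quarticExp : Fin 15 → Fin 3 → ℕ :=
  ![![0, 0, 4], ![0, 1, 3], ![0, 2, 2], ![0, 3, 1], ![0, 4, 0], ![1, 0, 3], ![1, 1, 2],
    ![1, 2, 1], ![1, 3, 0], ![2, 0, 2], ![2, 1, 1], ![2, 2, 0], ![3, 0, 1], ![3, 1, 0],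
    ![4, 0, 0]]

/-- The Gram matrix of the monomials of degree four for the inner product of `q₃⁴`. -/
def quarticGram : Matrix (Fin 15) (Fin 15) ℤ := .of fun i j =>
  gaussMoment (quarticExp i 0 + quarticExp j 0) * gaussMoment (quarticExp i 1 + quarticExp j 1) *
    gaussMoment (quarticExp i 2 + quarticExp j 2)

/-- The coefficients of `21 (x·y)⁴ - 14 (x·y)² q(x) q(y) + q(x)² q(y)²`. -/
def quarticKernel : Matrix (Fin 15) (Fin 15) ℤ :=
  !![8, 0, -12, 0, 1, 0, 0, 0, 0, -12, 0, 2, 0, 0, 1;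
     0, 56, 0, -28, 0, 0, 0, 0, 0, 0, -28, 0, 0, 0, 0;
     -12, 0, 102, 0, -12, 0, 0, 0, 0, -10, 0, -10, 0, 0, 2;
     0, -28, 0, 56, 0, 0, 0, 0, 0, 0, -28, 0, 0, 0, 0;
     1, 0, -12, 0, 8, 0, 0, 0, 0, 2, 0, -12, 0, 0, 1;
     0, 0, 0, 0, 0, 56, 0, -28, 0, 0, 0, 0, -28, 0, 0;
     0, 0, 0, 0, 0, 0, 224, 0, -28, 0, 0, 0, 0, -28, 0;
     0, 0, 0, 0, 0, -28, 0, 224, 0, 0, 0, 0, -28, 0, 0;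
     0, 0, 0, 0, 0, 0, -28, 0, 56, 0, 0, 0, 0, -28, 0;
     -12, 0, -10, 0, 2, 0, 0, 0, 0, 102, 0, -10, 0, 0, -12;
     0, -28, 0, -28, 0, 0, 0, 0, 0, 0, 224, 0, 0, 0, 0;
     2, 0, -10, 0, -12, 0, 0, 0, 0, -10, 0, 102, 0, 0, -12;
     0, 0, 0, 0, 0, -28, 0, -28, 0, 0, 0, 0, 56, 0, 0;
     0, 0, 0, 0, 0, 0, -28, 0, -28, 0, 0, 0, 0, 56, 0;
     1, 0, 2, 0, 1, 0, 0, 0, 0, -12, 0, -12, 0, 0, 8]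

/-- The spherical kernel 1 + 5P₂ + 9P₄ is 15/8 of this one, and degree-8 Gaussian moments are 945
times spherical means; 945 · 8/15 = 504. -/
lemma quarticGram_mul_quarticKernel : quarticGram * quarticKernel = 504 := by
  decide +kernel

/-- The matrix of values at the points `a l` of the monomials of degree four. -/
def quarticEval {r : ℕ} (a : Fin r → Fin 3 → ℂ) : Matrix (Fin r) (Fin 15) ℂ := .of fun l i =>
  a l 0 ^ quarticExp i 0 * a l 1 ^ quarticExp i 1 * a l 2 ^ quarticExp i 2

/-- The bilinear product `x · y`. -/
def dot (x y : Fin 3 → ℂ) : ℂ := x 0 * y 0 + x 1 * y 1 + x 2 * y 2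

lemma quarticEval_kernel_apply {r : ℕ} (a : Fin r → Fin 3 → ℂ) (i j : Fin r) :
    (quarticEval a * quarticKernel.map (Int.cast : ℤ → ℂ) * (quarticEval a).transpose) i j =
      21 * dot (a i) (a j) ^ 4 - 14 * dot (a i) (a j) ^ 2 * dot (a i) (a i) * dot (a j) (a j) +
        dot (a i) (a i) ^ 2 * dot (a j) (a j) ^ 2 := by
  simp only [Matrix.mul_apply, Matrix.transpose_apply, Matrix.map_apply, quarticEval,
    Matrix.of_apply]
  generalize a i = x
  generalize a j = y
  simp [Fin.sum_univ_succ, quarticExp, quarticKernel, dot]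
  ring

lemma quarticEval_gram {r : ℕ} {a : Fin r → Fin 3 → ℂ}
    (ha : quadForm 3 ^ 4 = ∑ l, linearForm (a l) ^ 8) :
    (105 : ℂ) • ((quarticEval a).transpose * quarticEval a) =
      quarticGram.map (Int.cast : ℤ → ℂ) := by
  ext i j
  have hs : ∀ i, quarticExp i 0 + quarticExp i 1 + quarticExp i 2 = 4 := by decide
  have h := sum_monomial_eq ha (quarticExp i 0 + quarticExp j 0) (quarticExp i 1 + quarticExp j 1)
    (quarticExp i 2 + quarticExp j 2) (by linarith [hs i, hs j])
  simp only [Matrix.smul_apply, Matrix.mul_apply, Matrix.transpose_apply, Matrix.map_apply,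
    quarticEval, quarticGram, Matrix.of_apply, smul_eq_mul]
  push_cast at h ⊢
  rw [← h]
  congr 1
  exact Finset.sum_congr rfl fun l _ => by ring

/-- In a tight decomposition the reproducing kernel is diagonal on the points. -/
lemma kernel_of_tight {a : Fin 15 → Fin 3 → ℂ}
    (ha : quadForm 3 ^ 4 = ∑ l, linearForm (a l) ^ 8) (i j : Fin 15) :
    5 * (21 * dot (a i) (a j) ^ 4 -
        14 * dot (a i) (a j) ^ 2 * dot (a i) (a i) * dot (a j) (a j) +
        dot (a i) (a i) ^ 2 * dot (a j) (a j) ^ 2) = if i = j then 24 else 0 := by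
  set V := quarticEval a
  set k := quarticKernel.map (Int.cast : ℤ → ℂ) with hk
  have h1 : (105 : ℂ) • (V.transpose * V * k) = 504 := by
    rw [← Matrix.smul_mul, quarticEval_gram ha]
    have h := congrArg (fun M : Matrix (Fin 15) (Fin 15) ℤ => M.map (Int.castRingHom ℂ))
      quarticGram_mul_quarticKernel
    simp only [Matrix.map_mul] at h
    refine Eq.trans h ?_
    exact map_ofNat (Int.castRingHom ℂ).mapMatrix 504
  have h2 : V.transpose * ((5 / 24 : ℂ) • (V * k)) = 1 := by
    rw [Matrix.mul_smul, ← Matrix.mul_assoc,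
      show (5 / 24 : ℂ) = (1 / 504) * 105 by norm_num, mul_smul, h1]
    ext i j
    rw [← Matrix.diagonal_ofNat, Matrix.smul_apply, Matrix.diagonal_apply, Matrix.one_apply]
    split_ifs <;> simp
  -- Tightness enters here: for square matrices a left inverse is a right inverse.
  have h3 := congrArg (fun M => M i j) (mul_eq_one_comm.1 h2)
  beta_reduce at h3
  rw [Matrix.smul_mul, Matrix.smul_apply, quarticEval_kernel_apply, smul_eq_mul,
    Matrix.one_apply] at h3
  split_ifs at h3 ⊢ <;> linear_combination 24 * h3

/-- On quadratic monomials, the factor q³ multiplies Gaussian moments by 5 · 7 · 9 = 315 = 3 · 105.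
-/
lemma sum_monomial_mul_dot_pow {r : ℕ} {a : Fin r → Fin 3 → ℂ}
    (ha : quadForm 3 ^ 4 = ∑ l, linearForm (a l) ^ 8) (i j k : ℕ) (hd : i + j + k = 2) :
    ∑ l, a l 0 ^ i * a l 1 ^ j * a l 2 ^ k * dot (a l) (a l) ^ 3 =
      (3 * (gaussMoment i * gaussMoment j * gaussMoment k) : ℕ) := by
  have m := sum_monomial_eq ha
  have e : ∀ x : Fin 3 → ℂ, x 0 ^ i * x 1 ^ j * x 2 ^ k * dot x x ^ 3 =
      x 0 ^ (i + 6) * x 1 ^ j * x 2 ^ k + x 0 ^ i * x 1 ^ (j + 6) * x 2 ^ k +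
      x 0 ^ i * x 1 ^ j * x 2 ^ (k + 6) + 3 * (x 0 ^ (i + 4) * x 1 ^ (j + 2) * x 2 ^ k) +
      3 * (x 0 ^ (i + 4) * x 1 ^ j * x 2 ^ (k + 2)) +
      3 * (x 0 ^ (i + 2) * x 1 ^ (j + 4) * x 2 ^ k) +
      3 * (x 0 ^ i * x 1 ^ (j + 4) * x 2 ^ (k + 2)) +
      3 * (x 0 ^ (i + 2) * x 1 ^ j * x 2 ^ (k + 4)) +
      3 * (x 0 ^ i * x 1 ^ (j + 2) * x 2 ^ (k + 4)) +
      6 * (x 0 ^ (i + 2) * x 1 ^ (j + 2) * x 2 ^ (k + 2)) := by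
    intro x
    simp only [dot, pow_add]
    ring
  simp_rw [e, Finset.sum_add_distrib, ← Finset.mul_sum]
  have key : ∀ i < 3, ∀ j < 3, ∀ k < 3, i + j + k = 2 →
      105 * (3 * (gaussMoment i * gaussMoment j * gaussMoment k)) =
      gaussMoment (i + 6) * gaussMoment j * gaussMoment k +
      gaussMoment i * gaussMoment (j + 6) * gaussMoment k +
      gaussMoment i * gaussMoment j * gaussMoment (k + 6) +
      3 * (gaussMoment (i + 4) * gaussMoment (j + 2) * gaussMoment k) +
      3 * (gaussMoment (i + 4) * gaussMoment j * gaussMoment (k + 2)) +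
      3 * (gaussMoment (i + 2) * gaussMoment (j + 4) * gaussMoment k) +
      3 * (gaussMoment i * gaussMoment (j + 4) * gaussMoment (k + 2)) +
      3 * (gaussMoment (i + 2) * gaussMoment j * gaussMoment (k + 4)) +
      3 * (gaussMoment i * gaussMoment (j + 2) * gaussMoment (k + 4)) +
      6 * (gaussMoment (i + 2) * gaussMoment (j + 2) * gaussMoment (k + 2)) := by decide
  have h := congrArg (Nat.cast (R := ℂ))
    (key i (by omega) j (by omega) k (by omega) hd)
  push_cast at h m ⊢
  linear_combination (m (i + 6) j k (by omega) + m i (j + 6) k (by omega) +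
    m i j (k + 6) (by omega) + 3 * m (i + 4) (j + 2) k (by omega) +
    3 * m (i + 4) j (k + 2) (by omega) + 3 * m (i + 2) (j + 4) k (by omega) +
    3 * m i (j + 4) (k + 2) (by omega) + 3 * m (i + 2) j (k + 4) (by omega) +
    3 * m i (j + 2) (k + 4) (by omega) + 6 * m (i + 2) (j + 2) (k + 2) (by omega) - h) / 105

lemma sum_dot_sq_mul {r : ℕ} {a : Fin r → Fin 3 → ℂ}
    (ha : quadForm 3 ^ 4 = ∑ l, linearForm (a l) ^ 8) (y : Fin 3 → ℂ) :
    ∑ l, dot y (a l) ^ 2 * dot (a l) (a l) ^ 3 = 3 * dot y y := by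
  have m := sum_monomial_mul_dot_pow ha
  have e : ∀ x : Fin 3 → ℂ, dot y x ^ 2 * dot x x ^ 3 =
      y 0 ^ 2 * (x 0 ^ 2 * x 1 ^ 0 * x 2 ^ 0 * dot x x ^ 3) +
      y 1 ^ 2 * (x 0 ^ 0 * x 1 ^ 2 * x 2 ^ 0 * dot x x ^ 3) +
      y 2 ^ 2 * (x 0 ^ 0 * x 1 ^ 0 * x 2 ^ 2 * dot x x ^ 3) +
      2 * y 0 * y 1 * (x 0 ^ 1 * x 1 ^ 1 * x 2 ^ 0 * dot x x ^ 3) +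
      2 * y 0 * y 2 * (x 0 ^ 1 * x 1 ^ 0 * x 2 ^ 1 * dot x x ^ 3) +
      2 * y 1 * y 2 * (x 0 ^ 0 * x 1 ^ 1 * x 2 ^ 1 * dot x x ^ 3) := by
    intro x
    rw [dot]
    ring
  simp_rw [e, Finset.sum_add_distrib, ← Finset.mul_sum]
  rw [m 2 0 0 rfl, m 0 2 0 rfl, m 0 0 2 rfl, m 1 1 0 rfl, m 1 0 1 rfl, m 0 1 1 rfl]
  simp [gaussMoment, dot]
  ring

/-! ### There is no tight decomposition -/

lemma not_tight (a : Fin 15 → Fin 3 → ℂ) : quadForm 3 ^ 4 ≠ ∑ l, linearForm (a l) ^ 8 := by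
  intro ha
  have hK := kernel_of_tight ha
  have hd : ∀ i, 5 * dot (a i) (a i) ^ 4 = 3 := fun i => by
    have := hK i i
    rw [if_pos rfl] at this
    linear_combination this / 8
  have h0 : ∀ i, dot (a i) (a i) ≠ 0 := fun i h => by
    have := hd i
    rw [h] at this
    norm_num at this
  -- Completing the square: (21u - 7)² - 28 = 21(21u² - 14u + 1), with u the normalised squared
  -- product.
  set s : Fin 15 → ℂ := fun j =>
    21 * (dot (a 0) (a j) ^ 2 / (dot (a 0) (a 0) * dot (a j) (a j))) - 7 with hs
  have hs0 : s 0 = 14 := by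
    have := h0 0
    simp only [hs]
    field_simp
    norm_num
  have hs2 : ∀ j, j ≠ 0 → s j ^ 2 = 28 := fun j hj => by
    have h := hK 0 j
    rw [if_neg hj.symm] at h
    have h1 := h0 0
    have h2 := h0 j
    simp only [hs]
    field_simp
    linear_combination 21 / 5 * h
  have hsum : ∑ j, s j = 0 := by
    have h := sum_dot_sq_mul ha (a 0)
    have h1 := h0 0
    -- Since q(aⱼ)⁴ = 3/5, 1/q(aⱼ) is 5/3 q(aⱼ)³, which turns the sum into a second moment.
    have e : ∀ j, s j = 35 / dot (a 0) (a 0) *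
        (dot (a 0) (a j) ^ 2 * dot (a j) (a j) ^ 3) - 7 := fun j => by
      have h2 := h0 j
      simp only [hs]
      field_simp
      linear_combination (-7 * dot (a 0) (a j) ^ 2) * hd j
    simp_rw [e]
    rw [Finset.sum_sub_distrib, ← Finset.mul_sum, h]
    field_simp
    norm_num
  obtain ⟨w, hw⟩ := IsAlgClosed.exists_pow_nat_eq (28 : ℂ) (n := 2) (by norm_num)
  have hm : ∀ j : Fin 14, ∃ m : ℤ, s j.succ = m * w := fun j => by
    have := hs2 j.succ (Fin.succ_ne_zero j)
    rw [← hw, sq_eq_sq_iff_eq_or_eq_neg] at this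
    rcases this with h | h
    · exact ⟨1, by simp [h]⟩
    · exact ⟨-1, by simp [h]⟩
  choose m hm using hm
  rw [Fin.sum_univ_succ, hs0] at hsum
  simp_rw [hm] at hsum
  rw [← Finset.sum_mul, ← Int.cast_sum] at hsum
  generalize (∑ i, m i) = z at hsum
  have h7 : ((z ^ 2 * 28 : ℤ) : ℂ) = (196 : ℤ) := by
    push_cast
    rw [← hw]
    linear_combination (z * w - 14) * hsum
  have h7' : z ^ 2 * 28 = 196 := by exact_mod_cast h7
  have hz : z ^ 2 = 7 := by omega
  have : -3 < z ∧ z < 3 := by constructor <;> nlinarith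
  obtain ⟨hl, hr⟩ := this
  interval_cases z <;> omega

lemma HasWaringDecomposition.add {n d r t : ℕ} {f g : MvPolynomial (Fin n) ℂ}
    (hf : HasWaringDecomposition d f r) (hg : HasWaringDecomposition d g t) :
    HasWaringDecomposition d (f + g) (r + t) := by
  obtain ⟨a, rfl⟩ := hf
  obtain ⟨b, rfl⟩ := hg
  exact ⟨Fin.append a b, by simp [Fin.sum_univ_add]⟩

lemma hasWaringDecomposition_zero {n d : ℕ} (hd : d ≠ 0) (r : ℕ) :
    HasWaringDecomposition d (0 : MvPolynomial (Fin n) ℂ) r :=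
  ⟨0, by simp [linearForm, hd]⟩

lemma sixteen_le_of_hasWaringDecomposition {r : ℕ}
    (h : HasWaringDecomposition 8 (quadForm 3 ^ 4) r) : 16 ≤ r := by
  by_contra! hr
  obtain ⟨t, ht⟩ := Nat.exists_eq_add_of_le (Nat.le_of_lt_succ hr)
  have := h.add (hasWaringDecomposition_zero (n := 3) (d := 8) (by norm_num) t)
  rw [add_zero, ← ht] at this
  obtain ⟨a, ha⟩ := this
  exact not_tight a ha

/-! ### A decomposition of size sixteen -/

lemma linearForm_smul {n : ℕ} (c : ℂ) (a : Fin n → ℂ) :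
    linearForm (c • a) = MvPolynomial.C c * linearForm a := by
  simp [linearForm, Finset.mul_sum, mul_assoc]

/-- A complex weight is absorbed into the forms through a `d`-th root. -/
lemma hasWaringDecomposition_C_mul {n d r : ℕ} (hd : 0 < d) (c : ℂ) (a : Fin r → Fin n → ℂ) :
    HasWaringDecomposition d (MvPolynomial.C c * ∑ j, linearForm (a j) ^ d) r := by
  obtain ⟨w, rfl⟩ := IsAlgClosed.exists_pow_nat_eq c hd
  exact ⟨fun j => w • a j, by simp [linearForm_smul, mul_pow, Finset.mul_sum]⟩

lemma add_pow_eight_add_sub_pow_eight {R : Type*} [CommRing R] (x y : R) :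
    (x + y) ^ 8 + (x - y) ^ 8 =
      2 * (x ^ 8 + 28 * x ^ 6 * y ^ 2 + 70 * x ^ 4 * y ^ 4 + 28 * x ^ 2 * y ^ 6 + y ^ 8) := by
  ring

/-- The sum of squares to the fourth power in terms of the six axes of an icosahedron and the ten
axes of its dual dodecahedron. -/
lemma icosahedral_identity {R : Type*} [CommRing R] {s : R} (hs : s ^ 2 = s + 1) (x y z : R) :
    140 * (x ^ 2 + y ^ 2 + z ^ 2) ^ 4 =
      3 * (5 - 3 * s) * ((y + s * z) ^ 8 + (y - s * z) ^ 8 + ((x + s * y) ^ 8 + (x - s * y) ^ 8) +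
        ((z + s * x) ^ 8 + (z - s * x) ^ 8)) +
      ((x + y + z) ^ 8 + (x + y - z) ^ 8 + (x - y + z) ^ 8 + (-x + y + z) ^ 8 +
        ((s * y + (s - 1) * z) ^ 8 + (s * y - (s - 1) * z) ^ 8) +
        ((s * x + (s - 1) * y) ^ 8 + (s * x - (s - 1) * y) ^ 8) +
        ((s * z + (s - 1) * x) ^ 8 + (s * z - (s - 1) * x) ^ 8)) := by
  -- Powers of s and of s - 1 = 1/s become affine in s, with Fibonacci coefficients.
  have h4 : s ^ 4 = 3 * s + 2 := by linear_combination (s ^ 2 + s + 2) * hs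
  have h6 : s ^ 6 = 8 * s + 5 := by linear_combination s ^ 2 * h4 + (3 * s + 5) * hs
  have h8 : s ^ 8 = 21 * s + 13 := by linear_combination s ^ 2 * h6 + (8 * s + 13) * hs
  have r2 : (s - 1) ^ 2 = 2 - s := by linear_combination hs
  have r4 : (s - 1) ^ 4 = 5 - 3 * s := by
    linear_combination ((s - 1) ^ 2 + 2 - s) * r2 + hs
  have r6 : (s - 1) ^ 6 = 13 - 8 * s := by
    linear_combination (s - 1) ^ 2 * r4 + (5 - 3 * s) * r2 + 3 * hs
  have r8 : (s - 1) ^ 8 = 34 - 21 * s := by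
    linear_combination ((s - 1) ^ 4 + 5 - 3 * s) * r4 + 9 * hs
  simp only [add_pow_eight_add_sub_pow_eight, mul_pow, hs, h4, h6, h8, r2, r4, r6, r8]
  ring_nf
  simp only [hs]
  ring

lemma hasWaringDecomposition_sixteen : HasWaringDecomposition 8 (quadForm 3 ^ 4) 16 := by
  obtain ⟨s, hs⟩ : ∃ s : ℂ, s ^ 2 = s + 1 :=
    ⟨Real.goldenRatio, by exact_mod_cast Real.goldenRatio_sq⟩
  have h := (hasWaringDecomposition_C_mul (d := 8) (by norm_num) (3 * (5 - 3 * s) / 140)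
    ![![0, 1, s], ![0, 1, -s], ![1, s, 0], ![1, -s, 0], ![s, 0, 1], ![-s, 0, 1]]).add
    (hasWaringDecomposition_C_mul (d := 8) (by norm_num) (1 / 140)
    ![![1, 1, 1], ![1, 1, -1], ![1, -1, 1], ![-1, 1, 1], ![0, s, s - 1], ![0, s, -(s - 1)],
      ![s, s - 1, 0], ![s, -(s - 1), 0], ![s - 1, 0, s], ![-(s - 1), 0, s]])
  convert h using 1
  have hs' : (MvPolynomial.C s : MvPolynomial (Fin 3) ℂ) ^ 2 = MvPolynomial.C s + 1 := by
    rw [← map_pow, hs, map_add, map_one]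
  have key := icosahedral_identity hs' (MvPolynomial.X 0) (MvPolynomial.X 1) (MvPolynomial.X 2)
  have hC : (MvPolynomial.C (1 / 140) * 140 : MvPolynomial (Fin 3) ℂ) = 1 := by
    rw [← map_ofNat MvPolynomial.C 140, ← map_mul]
    norm_num
  have hc : (MvPolynomial.C (3 * (5 - 3 * s) / 140) : MvPolynomial (Fin 3) ℂ) =
      MvPolynomial.C (1 / 140) * (3 * (5 - 3 * MvPolynomial.C s)) := by
    rw [div_eq_mul_one_div, mul_comm]
    simp only [map_mul, map_sub, map_ofNat]
  rw [hc]
  generalize (MvPolynomial.C (1 / 140) : MvPolynomial (Fin 3) ℂ) = c at *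
  simp [quadForm, linearForm, Fin.sum_univ_succ]
  linear_combination c * key -
    (MvPolynomial.X 0 ^ 2 + MvPolynomial.X 1 ^ 2 + MvPolynomial.X 2 ^ 2) ^ 4 * hC

theorem mainTheorem11 :
    waringRank 8 (quadForm 3 ^ 4) = tightSize 3 4 + 1 ∧ tightSize 3 4 + 1 = 16 := by
  have h16 : tightSize 3 4 + 1 = 16 := by decide
  refine ⟨?_, h16⟩
  rw [h16]
  exact le_antisymm (Nat.sInf_le hasWaringDecomposition_sixteen)
    (le_csInf ⟨16, hasWaringDecomposition_sixteen⟩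
      fun _ h => sixteen_le_of_hasWaringDecomposition h)
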